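/- Let $G$ be a finite simple graph. Denote by $RT(G)$ the graph obtained from $G$ by changing each edge and each vertex into a triangle: for every edge $e=ab$ of $G$ add a new vertex $e'$ and the edges $ae'$, $be'$, and for every vertex $v$ of $G$ add two new vertices $w_1^v, w_2^v$ and the edges $vw_1^v$, $vw_2^v$, $w_1^vw_2^v$ (all edges of $G$ are kept). For a connected finite graph $H$, let $r_{xy}$ be the resistance distance of the vertices $x,y$, i.e. the effective resistance between them when every edge of $H$ is replaced by a unit resistor, and let the Kirchhoff index be $Kf(H)=\sum_{\{x,y\}\subseteq V(H)} r_{xy}$, the sum over all unordered pairs of distinct vertices. **Theorem.** Let $G$ be a connected $r$-regular graph with $n$ vertices. Then $$Kf(RT(G))=\frac{(r+6)^2}{6}\,Kf(G)+\frac{(r+5)n}{2}+\frac{(r+6)(5n-4)n}{6}+\frac{(r-2)(r+6)n^2}{8}.$$ -/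

import Mathlib

/-- Every edge of `G` is a unit resistor.  `v` is a potential of the network when a unit current
enters at `a` and leaves at `b`: by Ohm's law the current from `x` to an adjacent `y` is
`v x - v y`, and by Kirchhoff's current law the total current flowing out of `x` along the edges
is the external current supplied at `x`. -/
def IsUnitCurrentPotential {V : Type*} [Fintype V] (G : SimpleGraph V) (a b : V)
    (v : V → ℝ) : Prop :=
  open Classical in
  ∀ x, ∑ y ∈ G.neighborFinset x, (v x - v y) =
    (if x = a then (1 : ℝ) else 0) - (if x = b then (1 : ℝ) else 0)

/-- Resistance distance: the effective resistance between `a` and `b`, i.e. the potential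
difference that drives a unit current from `a` to `b`.  In a connected graph such a potential
exists, and the potential difference does not depend on its choice (see
`exists_isUnitCurrentPotential` and `IsUnitCurrentPotential.resistanceDist_eq`). -/
noncomputable def resistanceDist {V : Type*} [Fintype V] (G : SimpleGraph V) (a b : V) : ℝ :=
  open Classical in
  if h : ∃ v, IsUnitCurrentPotential G a b v then h.choose a - h.choose b else 0

/-- Kirchhoff index: the sum of the resistance distances over all unordered pairs of vertices
(half the sum over ordered pairs; the diagonal terms vanish). -/
noncomputable def kirchhoffIndex {V : Type*} [Fintype V] (G : SimpleGraph V) : ℝ :=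
  (1 / 2) * ∑ a, ∑ b, resistanceDist G a b

/-- Vertices of `RT(G)`: the vertices `v` of `G`, one vertex `e'` for every edge `e` of `G`, and
two vertices `w₁ᵛ`, `w₂ᵛ` for every vertex `v` of `G`. -/
abbrev RTVertex {V : Type*} (G : SimpleGraph V) : Type _ := V ⊕ (G.edgeSet ⊕ (V × Fin 2))

/-- `RT(G)`: keep the edges of `G`, join `e'` to the two ends of `e` for every edge `e`, and join
`v`, `w₁ᵛ`, `w₂ᵛ` pairwise for every vertex `v`. -/
def RT {V : Type*} (G : SimpleGraph V) : SimpleGraph (RTVertex G) where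
  Adj
    | .inl u, .inl v => G.Adj u v
    | .inl u, .inr (.inl e) => u ∈ (e : Sym2 V)
    | .inr (.inl e), .inl u => u ∈ (e : Sym2 V)
    | .inl u, .inr (.inr w) => w.1 = u
    | .inr (.inr w), .inl u => w.1 = u
    | .inr (.inr w), .inr (.inr w') => w.1 = w'.1 ∧ w.2 ≠ w'.2
    | .inr (.inl _), .inr _ => False
    | .inr (.inr _), .inr (.inl _) => False
  symm := ⟨by
    rintro (u | e | w) (v | f | w') h
    all_goals first | exact h | exact SimpleGraph.Adj.symm h | exact ⟨h.1.symm, h.2.symm⟩⟩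
  loopless := ⟨by
    rintro (u | e | w) h
    · exact G.irrefl h
    · exact h
    · exact h.2 rfl⟩

theorem isUnitCurrentPotential_iff {V : Type*} [Fintype V] [DecidableEq V] (G : SimpleGraph V)
    [DecidableRel G.Adj] (a b : V) (v : V → ℝ) :
    IsUnitCurrentPotential G a b v ↔
      (G.lapMatrix ℝ).mulVec v = Pi.single a 1 - Pi.single b 1 := by
  unfold IsUnitCurrentPotential
  rw [funext_iff]
  refine forall_congr' fun x => ?_
  rw [SimpleGraph.lapMatrix_mulVec_apply, Finset.sum_sub_distrib]
  simp only [Finset.sum_const, SimpleGraph.card_neighborFinset_eq_degree, nsmul_eq_mul,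
    Pi.sub_apply, Pi.single_apply]
  convert Iff.rfl

/-- The potential difference does not depend on the potential. -/
theorem IsUnitCurrentPotential.resistanceDist_eq {V : Type*} [Fintype V] {G : SimpleGraph V}
    {a b : V} {v : V → ℝ} (hv : IsUnitCurrentPotential G a b v) :
    resistanceDist G a b = v a - v b := by
  classical
  have h : ∃ v, IsUnitCurrentPotential G a b v := ⟨v, hv⟩
  rw [resistanceDist, dif_pos h]
  have hu := (isUnitCurrentPotential_iff G a b _).1 h.choose_spec
  rw [isUnitCurrentPotential_iff] at hv
  generalize h.choose = u at hu ⊢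
  have key : dotProduct u ((G.lapMatrix ℝ).mulVec v) =
      dotProduct v ((G.lapMatrix ℝ).mulVec u) := by
    rw [Matrix.dotProduct_mulVec, ← Matrix.mulVec_transpose, (G.isSymm_lapMatrix (R := ℝ)).eq,
      dotProduct_comm]
  rw [hu, hv] at key
  simpa [dotProduct_sub] using key

/-- In a connected graph a unit current can be driven between any two vertices. -/
theorem exists_isUnitCurrentPotential {V : Type*} [Fintype V] {G : SimpleGraph V}
    (hG : G.Connected) (a b : V) : ∃ v, IsUnitCurrentPotential G a b v := by
  classical
  have hne := hG.nonempty
  have hsum : ∀ v : V → ℝ, ∑ x, (G.lapMatrix ℝ).mulVec v x = 0 := by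
    intro v
    have : dotProduct (fun _ => (1 : ℝ)) ((G.lapMatrix ℝ).mulVec v) = 0 := by
      rw [Matrix.dotProduct_mulVec, ← Matrix.mulVec_transpose, (G.isSymm_lapMatrix (R := ℝ)).eq,
        SimpleGraph.lapMatrix_mulVec_const_eq_zero, zero_dotProduct]
    simpa [dotProduct] using this
  let f : (V → ℝ) →ₗ[ℝ] (V → ℝ) :=
    (G.lapMatrix ℝ).mulVecLin + LinearMap.pi fun _ => ∑ y, LinearMap.proj y
  have hf : ∀ v x, f v x = (G.lapMatrix ℝ).mulVec v x + ∑ y, v y := by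
    intro v x
    simp [f]
  have hs : ∀ v, ∑ x, f v x = 0 → ∑ y, v y = 0 := by
    intro v h
    simp only [hf, Finset.sum_add_distrib, hsum, zero_add, Finset.sum_const, nsmul_eq_mul] at h
    simpa using h
  have hinj : Function.Injective f := by
    rw [injective_iff_map_eq_zero]
    intro v h
    have h0 : ∑ y, v y = 0 := hs v (by simp [h])
    have hL : (G.lapMatrix ℝ).mulVec v = 0 := by
      funext x
      simpa [hf, h0] using congrFun h x
    have hc := (G.lapMatrix_mulVec_eq_zero_iff_forall_reachable).1 hL
    funext x
    have : ∑ y, v y = ∑ _y : V, v x := Finset.sum_congr rfl fun y _ => hc y x (hG.preconnected y x)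
    rw [h0] at this
    simpa using this.symm
  obtain ⟨v, hv⟩ := (LinearMap.injective_iff_surjective.1 hinj)
    (Pi.single a 1 - Pi.single b 1)
  have h0 : ∑ y, v y = 0 := hs v (by simp [hv])
  refine ⟨v, (isUnitCurrentPotential_iff G a b v).2 ?_⟩
  funext x
  rw [← hv, hf, h0, add_zero]

/-!
The proof computes the Kirchhoff index from a Green function. If `K` solves `L K = 1 - c`, where
`L` is the Laplacian of a graph with `N` vertices and `c x` depends only on the row `x`, then
`K · a - K · b` is a unit current potential, so that `r_ab = K a a + K b b - K a b - K b a` and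
`Kf = N tr K - ∑ K` (`IsGreenFunction.kirchhoffIndex_eq`). A connected graph has such a `K` with
`c = 1 / N`.

The vertices added in `RT(G)` can be eliminated. The vertex `e'` of an edge `ab` takes the mean of
the potentials at `a` and `b` and turns the unit resistor `ab` into one of conductance
`1 + 1 / 2 = 3 / 2`; the vertices `w₁ᵛ`, `w₂ᵛ` take the potential of `v`. With `P` the matrix of
these weights (columns indexed by `RT(G)`) and `D` the inverse of the Laplacian block of the added
vertices, the matrix `K' = (2 / 3) Pᵀ K P + D` is therefore a Green function of `RT(G)`
(`RT.isGreenFunction_green`).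

If `G` is `r`-regular with adjacency matrix `A`, every row of `P` has the sum `3 + r / 2`, and
`P Pᵀ = (3 + r / 4) 1 + A / 4`. The first fact gives `∑ K'` in terms of `∑ K`. The second gives
`tr K'` in terms of `tr K` and `tr (A K)`, and the latter is `r tr K - (n - 1)` by the trace of
`L K = 1 - 1 / n`, a form of Foster's theorem (`IsGreenFunction.sum_adj`). Since `RT(G)` has
`n (r + 6) / 2` vertices, `tr K` and `∑ K` enter `Kf(RT(G))` exactly in the combination
`n tr K - ∑ K = Kf(G)`.
-/

/-! ### Green functions and the Kirchhoff index -/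

/-- `K` is a Green function of `H` with sink distribution `c`: for every `z`, the potential
`K · z` is driven by a unit current that enters at `z` and of which the amount `c x` leaves at
each vertex `x`.  Neither symmetry nor a normalisation of `K` is required. -/
def IsGreenFunction {W : Type*} [Fintype W] (H : SimpleGraph W) (K : W → W → ℝ)
    (c : W → ℝ) : Prop :=
  open Classical in
  ∀ x z, ∑ y, (if H.Adj x y then K x z - K y z else 0) = (if x = z then (1 : ℝ) else 0) - c x

theorem isUnitCurrentPotential_iff_sum_ite {W : Type*} [Fintype W] [DecidableEq W]
    {H : SimpleGraph W} [DecidableRel H.Adj] {a b : W} {v : W → ℝ} :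
    IsUnitCurrentPotential H a b v ↔
      ∀ x, ∑ y, (if H.Adj x y then v x - v y else 0) =
        (if x = a then (1 : ℝ) else 0) - (if x = b then (1 : ℝ) else 0) := by
  unfold IsUnitCurrentPotential
  refine forall_congr' fun x => ?_
  rw [SimpleGraph.neighborFinset_eq_filter, Finset.sum_filter]
  convert Iff.rfl

namespace IsGreenFunction

variable {W : Type*} [Fintype W] {H : SimpleGraph W} {K : W → W → ℝ} {c : W → ℝ}

theorem iff_sum_ite [DecidableEq W] [DecidableRel H.Adj] :
    IsGreenFunction H K c ↔ ∀ x z, ∑ y, (if H.Adj x y then K x z - K y z else 0) =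
      (if x = z then (1 : ℝ) else 0) - c x := by
  unfold IsGreenFunction
  convert Iff.rfl

theorem sum_ite [DecidableEq W] [DecidableRel H.Adj] (hK : IsGreenFunction H K c) (x z : W) :
    ∑ y, (if H.Adj x y then K x z - K y z else 0) = (if x = z then (1 : ℝ) else 0) - c x :=
  iff_sum_ite.1 hK x z

theorem resistanceDist_eq (hK : IsGreenFunction H K c) (a b : W) :
    resistanceDist H a b = K a a + K b b - K a b - K b a := by
  classical
  have h : IsUnitCurrentPotential H a b (fun x => K x a - K x b) := by
    rw [isUnitCurrentPotential_iff_sum_ite]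
    intro x
    have : ∀ y, (if H.Adj x y then K x a - K x b - (K y a - K y b) else 0) =
        (if H.Adj x y then K x a - K y a else 0) - (if H.Adj x y then K x b - K y b else 0) := by
      intro y
      split_ifs <;> ring
    simp only [this, Finset.sum_sub_distrib, hK.sum_ite]
    ring
  rw [h.resistanceDist_eq]
  ring

theorem kirchhoffIndex_eq (hK : IsGreenFunction H K c) :
    kirchhoffIndex H = Fintype.card W * ∑ x, K x x - ∑ x, ∑ y, K x y := by
  simp only [kirchhoffIndex, hK.resistanceDist_eq, Finset.sum_sub_distrib, Finset.sum_add_distrib,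
    Finset.sum_const, Finset.card_univ, nsmul_eq_mul, ← Finset.mul_sum]
  rw [Finset.sum_comm (f := fun x y => K y x)]
  ring

/-- The trace of the equation `L K = 1 - c`.  For the resistance distances it says that they add
up to `∑ x, (1 - c x)` over the edges, which is Foster's theorem. -/
theorem sum_adj [DecidableRel H.Adj] (hK : IsGreenFunction H K c) :
    ∑ x, ∑ y, (if H.Adj x y then K y x else 0) = ∑ x, H.degree x * K x x - ∑ x, (1 - c x) := by
  classical
  rw [← Finset.sum_sub_distrib]
  refine Finset.sum_congr rfl fun x _ => ?_
  have h := hK.sum_ite x x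
  have : ∀ y, (if H.Adj x y then K x x - K y x else 0) =
      (if H.Adj x y then K x x else 0) - (if H.Adj x y then K y x else 0) := by
    intro y
    split_ifs <;> ring
  simp only [this, Finset.sum_sub_distrib, if_true] at h
  have hd : ∑ y, (if H.Adj x y then K x x else 0) = H.degree x * K x x := by
    rw [← Finset.sum_filter, ← SimpleGraph.neighborFinset_eq_filter]
    simp
  rw [← h, hd]
  ring

end IsGreenFunction

/-- Averaging the unit current potentials over the exit vertex makes the current leave uniformly. -/
theorem SimpleGraph.Connected.exists_isGreenFunction {W : Type*} [Fintype W] {H : SimpleGraph W}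
    (hH : H.Connected) : ∃ K, IsGreenFunction H K fun _ => 1 / (Fintype.card W : ℝ) := by
  classical
  have := hH.nonempty
  choose v hv using exists_isUnitCurrentPotential hH
  simp only [isUnitCurrentPotential_iff_sum_ite] at hv
  refine ⟨fun x a => (∑ b, v a b x) / Fintype.card W, IsGreenFunction.iff_sum_ite.2 fun x z => ?_⟩
  have h1 : ∀ y, (if H.Adj x y then (∑ b, v z b x) / Fintype.card W -
      (∑ b, v z b y) / (Fintype.card W : ℝ) else 0) =
      (∑ b, if H.Adj x y then v z b x - v z b y else 0) / Fintype.card W := by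
    intro y
    split_ifs
    · rw [Finset.sum_sub_distrib, sub_div]
    · simp
  have h2 : ∑ y, (∑ b, if H.Adj x y then v z b x - v z b y else 0) / (Fintype.card W : ℝ) =
      (if x = z then (1 : ℝ) else 0) - 1 / Fintype.card W := by
    rw [← Finset.sum_div, Finset.sum_comm]
    simp only [hv, Finset.sum_sub_distrib, Finset.sum_const, Finset.card_univ, nsmul_eq_mul,
      Finset.sum_ite_eq, Finset.mem_univ, if_true]
    rw [sub_div, mul_div_cancel_left₀ _ (Nat.cast_ne_zero.2 Fintype.card_ne_zero)]
  simp only [← h2, ← h1]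

/-! ### Sums over edges -/

section Edges

variable {V : Type*} [Fintype V] [DecidableEq V] (G : SimpleGraph V) [DecidableRel G.Adj]

/-- The product of the incidence matrix with its transpose, as a sum over the edges of `G`. -/
theorem SimpleGraph.sum_edgeSet_mem_mul_mem (a b : V) :
    ∑ e : G.edgeSet, (if a ∈ (e : Sym2 V) then (1 : ℝ) else 0) * (if b ∈ (e : Sym2 V) then 1 else 0)
      = (if a = b then (G.degree a : ℝ) else 0) + if G.Adj a b then 1 else 0 := by
  have h := congrFun (congrFun (G.incMatrix_mul_transpose (R := ℝ)) a) b
  have h1 : ∑ e : G.edgeSet, (if a ∈ (e : Sym2 V) then (1 : ℝ) else 0) *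
      (if b ∈ (e : Sym2 V) then 1 else 0) = (G.incMatrix ℝ * (G.incMatrix ℝ).transpose) a b := by
    rw [Matrix.mul_apply, ← Finset.sum_subset (Finset.subset_univ G.edgeFinset)]
    · rw [Finset.sum_subtype G.edgeFinset (p := (· ∈ G.edgeSet)) (by simp)]
      refine Finset.sum_congr rfl fun e _ => ?_
      simp [SimpleGraph.incMatrix_apply', SimpleGraph.incidenceSet]
    · intro e _ he
      simp_all [SimpleGraph.incMatrix_apply', SimpleGraph.incidenceSet]
  rw [h1, h]
  by_cases hab : a = b
  · subst hab
    simp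
  · simp [hab]

/-- Summing over the edges at `a` the sum of a function over the two ends. -/
theorem SimpleGraph.sum_edgeSet_sum_mem (h : V → ℝ) (a : V) :
    ∑ e : G.edgeSet, (if a ∈ (e : Sym2 V) then ∑ u, (if u ∈ (e : Sym2 V) then h u else 0) else 0)
      = G.degree a * h a + ∑ u, if G.Adj a u then h u else 0 := by
  have : ∀ e : G.edgeSet, (if a ∈ (e : Sym2 V) then ∑ u, (if u ∈ (e : Sym2 V) then h u else 0)
      else 0) = ∑ u, ((if a ∈ (e : Sym2 V) then (1 : ℝ) else 0) *
        (if u ∈ (e : Sym2 V) then 1 else 0)) * h u := by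
    intro e
    split_ifs <;> simp
  simp only [this]
  rw [Finset.sum_comm]
  simp only [← Finset.sum_mul, G.sum_edgeSet_mem_mul_mem, add_mul, Finset.sum_add_distrib]
  simp

theorem SimpleGraph.sum_edgeSet_mem (a : V) (x : ℝ) :
    ∑ e : G.edgeSet, (if a ∈ (e : Sym2 V) then x else 0) = G.degree a * x := by
  have h := G.sum_edgeSet_mem_mul_mem a a
  simp only [← ite_and, and_self, if_true, SimpleGraph.irrefl, if_false, add_zero, mul_ite,
    mul_one, mul_zero] at h
  rw [← h, Finset.sum_mul]
  simp

end Edges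

theorem Sym2.sum_mem_of_ne {V : Type*} [Fintype V] [DecidableEq V] {a b : V} (h : a ≠ b)
    (f : V → ℝ) : ∑ u, (if u ∈ s(a, b) then f u else 0) = f a + f b := by
  rw [← Finset.sum_filter, show Finset.univ.filter (· ∈ s(a, b)) = {a, b} by ext; simp,
    Finset.sum_pair h]

/-! ### Vertices and neighbours in `RT(G)` -/

namespace RT

section Network

variable {V : Type*} [Fintype V] {G : SimpleGraph V} [DecidableRel G.Adj]

theorem sum_adj_inl [DecidableEq V] [DecidableRel (RT G).Adj] (F : RTVertex G → ℝ) (v : V) :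
    ∑ y, (if (RT G).Adj (.inl v) y then F y else 0) =
      (∑ u, if G.Adj v u then F (.inl u) else 0) +
        ((∑ e : G.edgeSet, if v ∈ (e : Sym2 V) then F (.inr (.inl e)) else 0) +
          ∑ i, F (.inr (.inr (v, i)))) := by
  rw [Fintype.sum_sum_type, Fintype.sum_sum_type, Fintype.sum_prod_type]
  refine congrArg₂ _ ?_ (congrArg₂ _ ?_ ?_)
  · exact Finset.sum_congr rfl fun u _ =>
      if_congr (Iff.rfl : (RT G).Adj (.inl v) (.inl u) ↔ G.Adj v u) rfl rfl
  · exact Finset.sum_congr rfl fun e _ =>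
      if_congr (Iff.rfl : (RT G).Adj (.inl v) (.inr (.inl e)) ↔ v ∈ (e : Sym2 V)) rfl rfl
  · rw [Finset.sum_eq_single v]
    · exact Finset.sum_congr rfl fun i _ => if_pos rfl
    · exact fun u _ hu => Finset.sum_eq_zero fun i _ => if_neg hu
    · simp

theorem sum_adj_edge [DecidableEq V] [DecidableRel (RT G).Adj] (F : RTVertex G → ℝ)
    (e : G.edgeSet) :
    ∑ y, (if (RT G).Adj (.inr (.inl e)) y then F y else 0) =
      ∑ u, if u ∈ (e : Sym2 V) then F (.inl u) else 0 := by
  rw [Fintype.sum_sum_type, ← add_zero (∑ u, if u ∈ (e : Sym2 V) then F (.inl u) else 0)]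
  exact congrArg₂ _ (Finset.sum_congr rfl fun u _ =>
      if_congr (Iff.rfl : (RT G).Adj (.inr (.inl e)) (.inl u) ↔ u ∈ (e : Sym2 V)) rfl rfl)
    (Finset.sum_eq_zero fun y _ => if_neg id)

/-- In `Fin 2`, `i + 1` is the index other than `i`. -/
theorem sum_adj_pair [DecidableRel (RT G).Adj] (F : RTVertex G → ℝ) (v : V)
    (i : Fin 2) :
    ∑ y, (if (RT G).Adj (.inr (.inr (v, i))) y then F y else 0) =
      F (.inl v) + F (.inr (.inr (v, i + 1))) := by
  rw [Fintype.sum_sum_type, Fintype.sum_sum_type]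
  congr 1
  · rw [Finset.sum_eq_single v]
    · exact if_pos rfl
    · exact fun u _ hu => if_neg (Ne.symm hu)
    · simp
  · refine (congrArg₂ _ (Finset.sum_eq_zero fun e _ => if_neg id) ?_).trans (zero_add _)
    rw [Finset.sum_eq_single (v, i + 1)]
    · refine if_pos ⟨rfl, ?_⟩
      fin_cases i <;> simp
    · rintro ⟨u, j⟩ _ hu
      refine if_neg fun h => hu ?_
      obtain ⟨rfl : v = u, h : i ≠ j⟩ := h
      fin_cases i <;> fin_cases j <;> simp at h ⊢
    · simp

theorem card_vertex : (Fintype.card (RTVertex G) : ℝ) =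
    3 * Fintype.card V + G.edgeFinset.card := by
  simp [SimpleGraph.edgeFinset_card]
  ring

end Network

/-! ### The Green function of `RT(G)` -/

variable {V : Type*} [DecidableEq V] {G : SimpleGraph V}

/-- The values of a potential of `RT(G)` at the vertices of `G` determine it wherever no external
current is supplied; `weight y u` is the coefficient of the value at `u` in the value at `y`.
Dually, it is the share of a current supplied at `y` that the rest of the network sees at `u`. -/
noncomputable def weight : RTVertex G → V → ℝ
  | .inl v, u => if u = v then 1 else 0
  | .inr (.inl e), u => if u ∈ (e : Sym2 V) then 1 / 2 else 0
  | .inr (.inr w), u => if u = w.1 then 1 else 0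

/-- The inverse of the block of the Laplacian of `RT(G)` indexed by the added vertices (the block
is `2` at each `e'` and `!![2, -1; -1, 2]` at each pair `w₁ᵛ, w₂ᵛ`), extended by zero. -/
noncomputable def localGreen : RTVertex G → RTVertex G → ℝ
  | .inr (.inl e), .inr (.inl f) => if (e : Sym2 V) = f then 1 / 2 else 0
  | .inr (.inr w), .inr (.inr w') =>
    if w.1 = w'.1 then (if w.2 = w'.2 then 2 / 3 else 1 / 3) else 0
  | _, _ => 0

theorem two_mul_localGreen_edge [DecidableEq (RTVertex G)] (e : G.edgeSet) (z : RTVertex G) :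
    2 * localGreen (.inr (.inl e)) z = if .inr (.inl e) = z then 1 else 0 := by
  rcases z with v | f | w
  · simp [localGreen]
  · simp [localGreen, Subtype.ext_iff]
  · simp [localGreen]

theorem two_mul_localGreen_pair_sub [DecidableEq (RTVertex G)] (v : V) (i : Fin 2)
    (z : RTVertex G) :
    2 * localGreen (.inr (.inr (v, i))) z - localGreen (.inr (.inr (v, i + 1))) z =
      if .inr (.inr (v, i)) = z then 1 else 0 := by
  rcases z with u | f | ⟨u, j⟩
  · simp [localGreen]
  · simp [localGreen]
  · by_cases h : v = u
    · fin_cases i <;> fin_cases j <;> simp [localGreen, h] <;> norm_num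
    · simp [localGreen, h]

variable [Fintype V]

/-- The Green function of `RT(G)` obtained from a Green function `K` of `G` by eliminating the
added vertices.  The elimination leaves `G` with all conductances equal to `1 + 1 / 2`, whence
the factor `2 / 3`. -/
noncomputable def green (K : V → V → ℝ) (x z : RTVertex G) : ℝ :=
  ∑ u, weight x u * (2 / 3 * ∑ t, weight z t * K u t) + localGreen x z

theorem green_inl (K : V → V → ℝ) (v : V) (z : RTVertex G) :
    green K (.inl v) z = 2 / 3 * ∑ t, weight z t * K v t := by
  simp [green, weight, localGreen]

theorem green_edge (K : V → V → ℝ) (e : G.edgeSet) (z : RTVertex G) :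
    green K (.inr (.inl e)) z =
      (∑ u, if u ∈ (e : Sym2 V) then green K (.inl u) z else 0) / 2
        + localGreen (.inr (.inl e)) z := by
  simp only [green_inl]
  simp only [green, weight, ite_mul, zero_mul, Finset.sum_div, ite_div, zero_div]
  congr! 3
  ring

theorem green_pair (K : V → V → ℝ) (w : V × Fin 2) (z : RTVertex G) :
    green K (.inr (.inr w)) z = green K (.inl w.1) z + localGreen (.inr (.inr w)) z := by
  simp [green, weight, localGreen]

theorem sum_edge_mem (e : G.edgeSet) (f : V → ℝ) :
    ∃ a b, ∑ u, (if u ∈ (e : Sym2 V) then f u else 0) = f a + f b := by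
  obtain ⟨e, he⟩ := e
  induction e with
  | h a b => exact ⟨a, b, Sym2.sum_mem_of_ne (G.ne_of_adj he) f⟩

theorem sum_edge_mem_const (e : G.edgeSet) (x : ℝ) :
    ∑ u, (if u ∈ (e : Sym2 V) then x else 0) = 2 * x := by
  obtain ⟨a, b, h⟩ := sum_edge_mem e fun _ => x
  rw [h, two_mul]

theorem sum_weight (z : RTVertex G) : ∑ t, weight z t = 1 := by
  rcases z with v | e | w
  · simp [weight]
  · simp [weight, sum_edge_mem_const]
  · simp [weight]

variable [DecidableRel G.Adj]

/-- A current supplied at `z` reaches `v` either directly or through the added vertices. -/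
theorem weight_eq [DecidableEq (RTVertex G)] (v : V) (z : RTVertex G) :
    weight z v = (if .inl v = z then 1 else 0) +
      (∑ e : G.edgeSet, if v ∈ (e : Sym2 V) then localGreen (.inr (.inl e)) z else 0) +
      ∑ i, localGreen (.inr (.inr (v, i))) z := by
  rcases z with u | f | ⟨u, j⟩
  · simp [weight, localGreen]
  · simp only [weight, localGreen, reduceCtorEq, if_false, zero_add, Finset.sum_const_zero,
      add_zero]
    rw [Finset.sum_eq_single f]
    · simp
    · intro e _ he
      simp [Subtype.ext_iff.not.1 he]
    · simp
  · by_cases h : v = u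
    · fin_cases j <;> simp [weight, localGreen, h, Fin.sum_univ_two] <;> norm_num
    · simp [weight, localGreen, h]

/-- On the vertices of `G`, `green K` is `2 / 3` of the potential that `K` gives to the reduced
current. -/
theorem sum_adj_green_inl {K : V → V → ℝ} {c : V → ℝ} (hK : IsGreenFunction G K c) (v : V)
    (z : RTVertex G) :
    ∑ u, (if G.Adj v u then green K (.inl v) z - green K (.inl u) z else 0) =
      2 / 3 * (weight z v - c v) := by
  have h : ∀ u, (if G.Adj v u then green K (.inl v) z - green K (.inl u) z else 0) =
      2 / 3 * ∑ t, weight z t * (if G.Adj v u then K v t - K u t else 0) := by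
    intro u
    split_ifs
    · simp only [green_inl, ← mul_sub, ← Finset.sum_sub_distrib]
    · simp
  simp only [h, ← Finset.mul_sum]
  rw [Finset.sum_comm]
  simp only [← Finset.mul_sum, hK.sum_ite, mul_sub, Finset.sum_sub_distrib, ← Finset.sum_mul,
    sum_weight]
  simp

/-- The current of the Green function of `RT(G)` leaves through the vertices of `G` only, with the
same distribution `c` as in `G`. -/
theorem isGreenFunction_green {K : V → V → ℝ} {c : V → ℝ} (hK : IsGreenFunction G K c) :
    IsGreenFunction (RT G) (green K) (Sum.elim c 0) := by
  classical
  refine IsGreenFunction.iff_sum_ite.2 fun x z => ?_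
  rcases x with v | e | ⟨v, i⟩
  · have h1 := sum_adj_green_inl hK v z
    have h2 := G.sum_edgeSet_sum_mem (fun u => green K (.inl u) z) v
    have h3 := G.sum_edgeSet_mem v (green K (.inl v) z)
    have h4 := weight_eq v z
    have h5 : ∑ u, (if G.Adj v u then green K (.inl v) z - green K (.inl u) z else 0) =
        G.degree v * green K (.inl v) z - ∑ u, if G.Adj v u then green K (.inl u) z else 0 := by
      simp only [← Finset.sum_filter, ← SimpleGraph.neighborFinset_eq_filter]
      simp
    have h6 : ∀ e : G.edgeSet, (if v ∈ (e : Sym2 V) then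
        green K (.inl v) z - green K (.inr (.inl e)) z else 0) =
        (if v ∈ (e : Sym2 V) then green K (.inl v) z else 0)
        - (if v ∈ (e : Sym2 V) then ∑ u, (if u ∈ (e : Sym2 V) then green K (.inl u) z else 0)
            else 0) / 2
        - (if v ∈ (e : Sym2 V) then localGreen (.inr (.inl e)) z else 0) := by
      intro e
      rw [green_edge]
      split_ifs <;> ring
    have h7 := sum_adj_inl (fun y => green K (.inl v) z - green K y z) v
    simp only [h6, Finset.sum_sub_distrib, ← Finset.sum_div, green_pair] at h7
    -- The edges `vu` of `G` and the paths through their added vertices have conductances `1` and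
    -- `1 / 2`, and `(1 + 1 / 2) * (2 / 3) = 1`.
    rw [h7, h2, h3, Sum.elim_inl, Finset.sum_add_distrib]
    linarith
  · have h := sum_adj_edge (fun y => green K (.inr (.inl e)) z - green K y z) e
    have h1 : ∀ u, (if u ∈ (e : Sym2 V) then
        green K (.inr (.inl e)) z - green K (.inl u) z else 0) =
        (if u ∈ (e : Sym2 V) then green K (.inr (.inl e)) z else 0) -
          (if u ∈ (e : Sym2 V) then green K (.inl u) z else 0) := by
      intro u
      split_ifs <;> ring
    simp only [h1, Finset.sum_sub_distrib, sum_edge_mem_const] at h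
    simp only [Sum.elim_inr, Pi.zero_apply, sub_zero]
    rw [h, ← two_mul_localGreen_edge, green_edge]
    ring
  · have h := sum_adj_pair (fun y => green K (.inr (.inr (v, i))) z - green K y z) v i
    simp only [Sum.elim_inr, Pi.zero_apply, sub_zero]
    rw [h, ← two_mul_localGreen_pair_sub, green_pair, green_pair]
    ring

/-! ### Trace and total sum -/

theorem sum_localGreen_self :
    ∑ x : RTVertex G, localGreen x x = G.edgeFinset.card / 2 + 4 / 3 * Fintype.card V := by
  simp [Fintype.sum_sum_type, localGreen, SimpleGraph.edgeFinset_card]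
  ring

theorem sum_sum_localGreen :
    ∑ x : RTVertex G, ∑ y, localGreen x y = G.edgeFinset.card / 2 + 2 * Fintype.card V := by
  have h1 : ∀ e : G.edgeSet, ∑ f : G.edgeSet, (if (e : Sym2 V) = f then (1 / 2 : ℝ) else 0)
      = 1 / 2 := by
    intro e
    simp [← Subtype.ext_iff]
  have h2 : ∀ w : V × Fin 2, ∑ w' : V × Fin 2, (if w.1 = w'.1 then
      (if w.2 = w'.2 then (2 / 3 : ℝ) else 1 / 3) else 0) = 1 := by
    rintro ⟨v, i⟩
    fin_cases i <;> simp [Fintype.sum_prod_type, Fin.sum_univ_two] <;>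
      norm_num
  simp only [Fintype.sum_sum_type, localGreen, h1, h2, Finset.sum_const_zero, zero_add, add_zero]
  simp [SimpleGraph.edgeFinset_card]
  ring

theorem sum_weight_left (u : V) :
    ∑ x : RTVertex G, weight x u = 3 + (G.degree u : ℝ) / 2 := by
  simp only [Fintype.sum_sum_type, Fintype.sum_prod_type_right, weight, G.sum_edgeSet_mem]
  simp
  ring

/-- An edge of `G` contributes `1 / 4` through its added vertex, to the diagonal entries of its ends
and to the entry that joins them. -/
theorem sum_weight_mul_weight (u t : V) :
    ∑ x : RTVertex G, weight x u * weight x t =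
      (if u = t then 3 + (G.degree u : ℝ) / 4 else 0) + if G.Adj u t then 1 / 4 else 0 := by
  have h := G.sum_edgeSet_mem_mul_mem u t
  have h1 : ∑ e : G.edgeSet, (if u ∈ (e : Sym2 V) then (1 / 2 : ℝ) else 0) *
      (if t ∈ (e : Sym2 V) then 1 / 2 else 0) =
      (∑ e : G.edgeSet, (if u ∈ (e : Sym2 V) then (1 : ℝ) else 0) *
        (if t ∈ (e : Sym2 V) then 1 else 0)) / 4 := by
    rw [Finset.sum_div]
    refine Finset.sum_congr rfl fun e _ => ?_
    split_ifs <;> norm_num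
  simp only [Fintype.sum_sum_type, Fintype.sum_prod_type, weight, h1, h]
  by_cases hut : u = t
  · subst hut
    simp
    ring
  · simp [hut]
    split_ifs <;> norm_num

theorem sum_sum_green {r : ℕ} (hreg : G.IsRegularOfDegree r) (K : V → V → ℝ) :
    ∑ x : RTVertex G, ∑ z, green K x z =
      ((r : ℝ) + 6) ^ 2 / 6 * ∑ u, ∑ t, K u t + ∑ x : RTVertex G, ∑ y, localGreen x y := by
  simp only [green, Finset.sum_add_distrib]
  congr 1
  calc ∑ x : RTVertex G, ∑ z : RTVertex G, ∑ u, weight x u * (2 / 3 * ∑ t, weight z t * K u t)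
      = ∑ u, (∑ x : RTVertex G, weight x u) *
          (2 / 3 * ∑ t, (∑ z : RTVertex G, weight z t) * K u t) := by
        simp only [Finset.mul_sum, Finset.sum_mul]
        rw [Finset.sum_congr rfl fun x _ => Finset.sum_comm, Finset.sum_comm]
        refine Finset.sum_congr rfl fun u _ => ?_
        rw [Finset.sum_comm, Finset.sum_congr rfl fun x _ => Finset.sum_comm, Finset.sum_comm]
    _ = _ := by
        simp only [sum_weight_left, hreg.degree_eq, ← Finset.mul_sum]
        ring

theorem sum_green_self {r : ℕ} (hreg : G.IsRegularOfDegree r) (K : V → V → ℝ) :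
    ∑ x : RTVertex G, green K x x =
      2 / 3 * ((3 + (r : ℝ) / 4) * ∑ u, K u u + (∑ u, ∑ t, if G.Adj u t then K t u else 0) / 4)
        + ∑ x : RTVertex G, localGreen x x := by
  simp only [green, Finset.sum_add_distrib]
  congr 1
  calc ∑ x : RTVertex G, ∑ u, weight x u * (2 / 3 * ∑ t, weight x t * K u t)
      = 2 / 3 * ∑ u, ∑ t, (∑ x : RTVertex G, weight x u * weight x t) * K u t := by
        simp only [Finset.mul_sum, Finset.sum_mul]
        rw [Finset.sum_comm]
        refine Finset.sum_congr rfl fun u _ => ?_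
        rw [Finset.sum_comm]
        refine Finset.sum_congr rfl fun t _ => Finset.sum_congr rfl fun x _ => ?_
        ring
    _ = _ := by
        rw [Finset.sum_comm (f := fun u t => if G.Adj u t then K t u else 0)]
        simp only [sum_weight_mul_weight, hreg.degree_eq, add_mul, ite_mul, zero_mul,
          Finset.sum_add_distrib, Finset.sum_ite_eq, Finset.mem_univ, if_true, Finset.mul_sum,
          Finset.sum_div, ite_div, zero_div, G.adj_comm]
        ring_nf

end RT

theorem theorem4p4 {V : Type*} [Fintype V] [DecidableEq V] (G : SimpleGraph V)
    [DecidableRel G.Adj] (n r : ℕ) (hn : Fintype.card V = n) (hconn : G.Connected)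
    (hreg : G.IsRegularOfDegree r) :
    kirchhoffIndex (RT G) =
      ((r : ℝ) + 6) ^ 2 / 6 * kirchhoffIndex G
        + ((r : ℝ) + 5) * n / 2
        + ((r : ℝ) + 6) * (5 * n - 4) * n / 6
        + ((r : ℝ) - 2) * (r + 6) * (n : ℝ) ^ 2 / 8 := by
  have := hconn.nonempty
  have hn0 : (n : ℝ) ≠ 0 := by
    rw [← hn]
    exact Nat.cast_ne_zero.2 Fintype.card_ne_zero
  have hm : (G.edgeFinset.card : ℝ) = n * r / 2 := by
    have h := G.sum_degrees_eq_twice_card_edges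
    simp only [hreg.degree_eq, Finset.sum_const, Finset.card_univ, hn, smul_eq_mul] at h
    rw [eq_div_iff two_ne_zero]
    exact_mod_cast (h.trans (mul_comm _ _)).symm
  obtain ⟨K, hK⟩ := hconn.exists_isGreenFunction
  have hfoster := hK.sum_adj
  simp only [hreg.degree_eq, Finset.sum_const, Finset.card_univ, hn, nsmul_eq_mul,
    ← Finset.mul_sum, mul_sub, mul_one, mul_one_div_cancel hn0] at hfoster
  rw [(RT.isGreenFunction_green hK).kirchhoffIndex_eq, hK.kirchhoffIndex_eq,
    RT.sum_sum_green hreg, RT.sum_green_self hreg, RT.sum_sum_localGreen, RT.sum_localGreen_self,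
    RT.card_vertex, hfoster, hm, hn]
  ring
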